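/- Let $n\ge 0$ and $N\ge 2n$ be integers. Let $E=\mathbb{C}^N\oplus\mathbb{C}^N$ with standard orthonormal bases $e_1,\dots,e_N$ and $f_1,\dots,f_N$ of the two summands, and let $z\colon E\to E$ be the nilpotent endomorphism with $ze_j=e_{j-1}$, $zf_j=f_{j-1}$ for $j\ge 2$ and $ze_1=zf_1=0$. Let $C\colon E\to\mathbb{C}^2$ be the linear map with $C(e_j)=e$, $C(f_j)=f$ for all $j$, where $e,f$ is the standard basis of $\mathbb{C}^2$. Put $E_n=\mathrm{span}(e_1,\dots,e_n,f_1,\dots,f_n)$ and let $z_n\colon E_n\to E_n$ be the restriction of $z$. Let $$Y_{2n}=\{(L_1,\dots,L_{2n}) : 0=L_0\subsetneq L_1\subsetneq\dots\subsetneq L_{2n}\subset E,\ \dim L_j=j,\ zL_j\subset L_j\ \text{for all } j\},$$ which contains the Springer variety $\mathfrak{B}_{n,n}=\{(L_1,\dots,L_{2n})\in Y_{2n} : L_{2n}=E_n\}$. Define $\phi_{2n}\colon Y_{2n}\to(\mathbb{P}^1)^{2n}$ by letting the $j$-th component of $\phi_{2n}(L_1,\dots,L_{2n})$ be the line $C(L_j\cap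 L_{j-1}^{\perp})\subset\mathbb{C}^2$, and define $I_{2n}\colon(\mathbb{P}^1)^{2n}\to(\mathbb{P}^1)^{2n}$ by replacing $l_j$ by its orthogonal complement $l_j^\perp\subset\mathbb{C}^2$ for every even $j$ and keeping $l_j$ for every odd $j$. Let $B^n$ be the set of crossingless matchings of $2n$ points, i.e. of partitions of $\{1,\dots,2n\}$ into pairs such that there are no $i<j<k<l$ with $i$ paired to $k$ and $j$ paired to $l$. For $a\in B^n$ let $O_a$ be the set of the smaller elements of the pairs of $a$, and for $j\in O_a$ let $s_a(j)>j$ be the element paired with $j$ and $d_a(j)=(s_a(j)-j+1)/2$. Put $$K_a=\{(L_1,\dots,L_{2n})\in\mathfrak{B}_{n,n} : L_{s_a(j)}=z_n^{-d_a(j)}L_{j-1}\ \text{for all } j\in O_a\},$$ $$S_a=\{(l_1,\dots,l_{2n})\in(\mathbb{P}^1)^{2n} : l_j=l_{s_a(j)}\ \text{for all } j\in O_a\},\qquad \widetilde S=\bigcup_{a\in B^n}S_a .$$ Then $I_{2n}\circ\phi_{2n}\colon Y_{2n}\to(\mathbb{P}^1)^{2n}$ is a diffeomorphism, it maps $K_a$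 onto $S_a$ for every $a\in B^n$, and it maps $\mathfrak{B}_{n,n}$ onto $\widetilde S$. -/

import Mathlib

open scoped LinearAlgebra.Projectivization ContDiff

noncomputable section

namespace Springer

/-- `E = ℂ^N ⊕ ℂ^N` with its standard hermitian product. The basis vector at `(0, j)` is
`e_{j+1}` and the one at `(1, j)` is `f_{j+1}` (indices in `Fin N` start at `0`). -/
abbrev E (N : ℕ) : Type := EuclideanSpace ℂ (Fin 2 × Fin N)

/-- `ℂ²` with its standard hermitian product; its standard basis is `(e, f)`. -/
abbrev C2 : Type := EuclideanSpace ℂ (Fin 2)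

/-- The complex projective line: complex lines through the origin of `ℂ²`. -/
abbrev P1 : Type := ℙ ℂ C2

/-- The nilpotent endomorphism `z e_j = e_{j-1}`, `z f_j = f_{j-1}`, `z e_1 = z f_1 = 0`,
written in coordinates. -/
def z (N : ℕ) : E N →ₗ[ℂ] E N where
  toFun v := WithLp.toLp 2 fun p =>
    if h : (p.2 : ℕ) + 1 < N then v (p.1, ⟨(p.2 : ℕ) + 1, h⟩) else 0
  map_add' v w := by
    ext p
    by_cases h : (p.2 : ℕ) + 1 < N <;> simp [h]
  map_smul' c v := by
    ext p
    by_cases h : (p.2 : ℕ) + 1 < N <;> simp [h]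

/-- The linear map `C e_j = e`, `C f_j = f`, written in coordinates. -/
def C (N : ℕ) : E N →ₗ[ℂ] C2 where
  toFun v := WithLp.toLp 2 fun k => ∑ j : Fin N, v (k, j)
  map_add' v w := by
    ext k
    simp [Finset.sum_add_distrib]
  map_smul' c v := by
    ext k
    simp [Finset.mul_sum]

/-- `E_n = span(e_1, …, e_n) ⊕ span(f_1, …, f_n)`, as a subspace of `E`. -/
def En (N n : ℕ) : Submodule ℂ (E N) :=
  Submodule.span ℂ
    {v | ∃ (k : Fin 2) (j : Fin N), (j : ℕ) < n ∧ v = EuclideanSpace.single (k, j) (1 : ℂ)}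

/-- Flags `0 = L_0 ⊊ L_1 ⊊ … ⊊ L_m ⊆ E` with `dim L_j = j` and `z L_j ⊆ L_j` for all `j`. -/
@[ext]
structure Y (N m : ℕ) where
  L : Fin (m + 1) → Submodule ℂ (E N)
  strictMono : StrictMono L
  finrank_eq : ∀ j, Module.finrank ℂ (L j) = (j : ℕ)
  stable : ∀ j, (L j).map (z N) ≤ L j

/-! ### The lines `C(L_j ∩ L_{j-1}^⊥)` are one-dimensional -/

lemma z_apply {N : ℕ} (v : E N) (p : Fin 2 × Fin N) :
    z N v p = if h : (p.2 : ℕ) + 1 < N then v (p.1, ⟨(p.2 : ℕ) + 1, h⟩) else 0 := rfl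

lemma C_apply {N : ℕ} (v : E N) (k : Fin 2) : C N v k = ∑ j : Fin N, v (k, j) := rfl

lemma z_pow_apply {N : ℕ} (d : ℕ) (v : E N) (p : Fin 2 × Fin N) :
    (z N ^ d) v p = if h : (p.2 : ℕ) + d < N then v (p.1, ⟨(p.2 : ℕ) + d, h⟩) else 0 := by
  induction d generalizing v with
  | zero => simp
  | succ d ih =>
    rw [pow_succ, Module.End.mul_apply, ih]
    by_cases h : (p.2 : ℕ) + d < N
    · rw [dif_pos h, z_apply]
      rfl
    · rw [dif_neg h, dif_neg (by omega)]

lemma z_pow_eq_zero (N : ℕ) : z N ^ N = 0 := by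
  ext v p
  rw [z_pow_apply, dif_neg (by omega)]
  rfl

/-- `z` maps `L_j` to `L_{j-1}`. -/
lemma Y.z_mem {N m : ℕ} (F : Y N m) (j : Fin m) {v : E N} (hv : v ∈ F.L j.succ) :
    z N v ∈ F.L j.castSucc := by
  have hst : ∀ (i : Fin (m + 1)) {w : E N}, w ∈ F.L i → z N w ∈ F.L i := fun i w hw =>
    F.stable i (Submodule.mem_map_of_mem hw)
  by_contra hz
  have hle : F.L j.castSucc ⊔ Submodule.span ℂ {z N v} ≤ F.L j.succ :=
    sup_le (F.strictMono.monotone (Fin.castSucc_lt_succ).le)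
      ((Submodule.span_singleton_le_iff_mem _ _).2 (hst _ hv))
  have hlt : F.L j.castSucc < F.L j.castSucc ⊔ Submodule.span ℂ {z N v} := by
    refine lt_of_le_of_ne le_sup_left fun h => hz ?_
    rw [h]
    exact (le_sup_right : _ ≤ F.L j.castSucc ⊔ Submodule.span ℂ {z N v})
      (Submodule.mem_span_singleton_self _)
  have heq := Submodule.eq_of_le_of_finrank_le hle (by
    have := Submodule.finrank_lt_finrank_of_lt hlt
    rw [F.finrank_eq] at this ⊢
    simpa using this)
  rw [← heq] at hv
  obtain ⟨w, hw, y, hy, hwy⟩ := Submodule.mem_sup.1 hv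
  obtain ⟨c, rfl⟩ := Submodule.mem_span_singleton.1 hy
  have key : ∀ k : ℕ, ∃ w' ∈ F.L j.castSucc, ∃ c' : ℂ, v = w' + c' • (z N ^ k) v := by
    intro k
    induction k with
    | zero => exact ⟨0, zero_mem _, 1, by simp⟩
    | succ k ih =>
      obtain ⟨w', hw', c', h⟩ := ih
      refine ⟨w + c • z N w', add_mem hw (Submodule.smul_mem _ _ (hst _ hw')), c * c', ?_⟩
      have h' : z N v = z N w' + c' • (z N ^ (k + 1)) v := by
        conv_lhs => rw [h]
        rw [map_add, map_smul, pow_succ', Module.End.mul_apply]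
      conv_lhs => rw [← hwy, h']
      rw [smul_add, smul_smul, add_assoc]
  obtain ⟨w', hw', c', h⟩ := key N
  rw [z_pow_eq_zero, LinearMap.zero_apply, smul_zero, add_zero] at h
  exact hz (hst _ (h ▸ hw'))

/-- The restriction of `C` to `L_j ∩ L_{j-1}^⊥` is injective. -/
lemma Y.C_injOn {N m : ℕ} (F : Y N m) (j : Fin m) {v : E N} (hv : v ∈ F.L j.succ)
    (hv' : v ∈ (F.L j.castSucc)ᗮ) (h : C N v = 0) : v = 0 := by
  obtain _ | M := N
  · ext p
    exact p.2.elim0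
  set u : E (M + 1) := ∑ d ∈ Finset.range (M + 1), (z (M + 1) ^ d) v with hu
  have hst : ∀ d : ℕ, (z (M + 1) ^ (d + 1)) v ∈ F.L j.castSucc := by
    intro d
    induction d with
    | zero => simpa using F.z_mem j hv
    | succ d ih =>
      rw [pow_succ', Module.End.mul_apply]
      exact F.stable _ (Submodule.mem_map_of_mem ih)
  have hzu : z (M + 1) u = ∑ d ∈ Finset.range (M + 1), (z (M + 1) ^ (d + 1)) v := by
    rw [hu, map_sum]
    exact Finset.sum_congr rfl fun d _ => by rw [pow_succ', Module.End.mul_apply]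
  have hmem : z (M + 1) u ∈ F.L j.castSucc := hzu ▸ Submodule.sum_mem _ fun d _ => hst d
  have huv : u = z (M + 1) u + v := by
    rw [hzu, Finset.sum_range_succ, z_pow_eq_zero, LinearMap.zero_apply, add_zero, hu,
      Finset.sum_range_succ', pow_zero, Module.End.one_apply]
  have hu0 : ∀ k, u (k, 0) = 0 := by
    intro k
    have hk : C (M + 1) v k = 0 := by rw [h]; rfl
    rw [C_apply] at hk
    rw [hu, WithLp.ofLp_sum, Finset.sum_apply, Finset.sum_range, ← hk]
    refine Finset.sum_congr rfl fun d _ => ?_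
    rw [z_pow_apply, dif_pos (by simpa using d.is_le)]
    simp
  have hnorm : ‖z (M + 1) u‖ ^ 2 = ‖u‖ ^ 2 := by
    rw [EuclideanSpace.norm_sq_eq, EuclideanSpace.norm_sq_eq, Fintype.sum_prod_type,
      Fintype.sum_prod_type]
    refine Finset.sum_congr rfl fun k _ => ?_
    rw [Fin.sum_univ_castSucc, Fin.sum_univ_succ, hu0]
    simp [z_apply, Fin.succ]
  have hin : inner ℂ (z (M + 1) u) v = 0 := Submodule.inner_right_of_mem_orthogonal hmem hv'
  have hadd := @norm_add_sq ℂ _ _ _ _ (z (M + 1) u) v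
  rw [← huv, hin, hnorm] at hadd
  have : ‖v‖ ^ 2 = 0 := by simpa using hadd
  simpa using this

lemma Y.finrank_line {N m : ℕ} (F : Y N m) (j : Fin m) :
    Module.finrank ℂ ((F.L j.succ ⊓ (F.L j.castSucc)ᗮ).map (C N)) = 1 := by
  have hle : F.L j.castSucc ≤ F.L j.succ := F.strictMono.monotone (Fin.castSucc_lt_succ).le
  have h1 := Submodule.finrank_add_inf_finrank_orthogonal hle
  rw [F.finrank_eq, F.finrank_eq, inf_comm] at h1
  have h2 : Module.finrank ℂ ↥(F.L j.succ ⊓ (F.L j.castSucc)ᗮ) = 1 := by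
    simp at h1; omega
  rw [← h2]
  refine (LinearEquiv.finrank_eq (LinearEquiv.ofBijective
    ((C N).submoduleMap (F.L j.succ ⊓ (F.L j.castSucc)ᗮ)) ⟨?_, ?_⟩)).symm
  · rw [injective_iff_map_eq_zero]
    rintro ⟨v, hv⟩ h
    have := F.C_injOn j hv.1 hv.2 (congrArg Subtype.val h)
    exact Subtype.ext this
  · exact LinearMap.submoduleMap_surjective _ _

/-- `φ_m(L_1, …, L_m) = (C(L_1), C(L_2 ∩ L_1^⊥), …, C(L_m ∩ L_{m-1}^⊥))`. -/
def phi (N m : ℕ) (F : Y N m) : Fin m → P1 := fun j =>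
  Projectivization.mk'' ((F.L j.succ ⊓ (F.L j.castSucc)ᗮ).map (C N)) (F.finrank_line j)

lemma finrank_perp (l : P1) : Module.finrank ℂ (l.submodule)ᗮ = 1 := by
  have h := Submodule.finrank_add_finrank_orthogonal l.submodule
  rw [Projectivization.finrank_submodule, finrank_euclideanSpace_fin] at h
  omega

/-- The orthogonal complement of a complex line in `ℂ²`. -/
def perp (l : P1) : P1 := Projectivization.mk'' (l.submodule)ᗮ (finrank_perp l)

/-- `I_m` replaces `l_j` by `l_j^⊥` for even `j`; the factor with index `j : Fin m` is the
`(j+1)`-st one. -/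
def I (m : ℕ) (l : Fin m → P1) : Fin m → P1 := fun j =>
  if Even ((j : ℕ) + 1) then perp (l j) else l j

/-- Crossingless matchings of `2n` points: partitions of the set of points into pairs, given by
the fixed point free involution that sends a point to its partner, such that there are no
`i < j < k < l` with `i` paired to `k` and `j` paired to `l`. -/
@[ext]
structure Matching (n : ℕ) where
  s : Fin (2 * n) → Fin (2 * n)
  involutive : Function.Involutive s
  ne_self : ∀ i, s i ≠ i
  crossingless : ¬ ∃ i j k l, i < j ∧ j < k ∧ k < l ∧ s i = k ∧ s j = l

/-- The set of left endpoints of the pairs of a matching. -/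
def Matching.O {n : ℕ} (a : Matching n) : Set (Fin (2 * n)) := {i | i < a.s i}

/-- `d_a(i) = (s_a(i) - i + 1) / 2`, for `i ∈ O_a`. -/
def Matching.d {n : ℕ} (a : Matching n) (i : Fin (2 * n)) : ℕ := ((a.s i : ℕ) - (i : ℕ) + 1) / 2

/-- The Springer variety `𝔅_{n,n}`: the flags in `Y_{2n}` with `L_{2n} = E_n`. -/
def B (N n : ℕ) : Set (Y N (2 * n)) := {F | F.L (Fin.last (2 * n)) = En N n}

/-- `z_n^{-d} W`, the preimage of `W` under the `d`-th power of the restriction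
`z_n : E_n → E_n` of `z`. -/
def zPre (N n d : ℕ) (W : Submodule ℂ (E N)) : Submodule ℂ (E N) := En N n ⊓ W.comap (z N ^ d)

/-- The component `K_a` of `𝔅_{n,n}`: the flags with `L_{s_a(j)} = z_n^{-d_a(j)} L_{j-1}` for all
`j ∈ O_a`. The point `j : Fin (2 * n)` is the `(j+1)`-st one, so `L_{s_a(j)}` is
`L (a.s j).succ` and `L_{j-1}` is `L j.castSucc`. -/
def K (N : ℕ) {n : ℕ} (a : Matching n) : Set (Y N (2 * n)) :=
  {F | F ∈ B N n ∧ ∀ j ∈ a.O, F.L (a.s j).succ = zPre N n (a.d j) (F.L j.castSucc)}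

/-- `S_a`: the tuples of lines with `l_j = l_{s_a(j)}` for all `j ∈ O_a`. -/
def S {n : ℕ} (a : Matching n) : Set (Fin (2 * n) → P1) := {l | ∀ j ∈ a.O, l j = l (a.s j)}

/-- `S̃`, the union of all `S_a`. -/
def STilde (n : ℕ) : Set (Fin (2 * n) → P1) := ⋃ a : Matching n, S a

/-! ### Diffeomorphisms

A Grassmannian is a smooth submanifold of a real vector space of endomorphisms, a subspace being
identified with the orthogonal projection onto it. In this way `Y_m` and `(ℙ¹)^m` are subsets of
finite-dimensional real vector spaces, and a map between such subsets is smooth if it extends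
locally to a smooth map between the vector spaces. -/

/-- A flag as a tuple of orthogonal projections. -/
def flagProj (N m : ℕ) (F : Y N m) : Fin (m + 1) → (E N →L[ℂ] E N) := fun j =>
  (F.L j).starProjection

/-- A tuple of lines as a tuple of orthogonal projections. -/
def lineProj (m : ℕ) (l : Fin m → P1) : Fin m → (C2 →L[ℂ] C2) := fun j =>
  (l j).submodule.starProjection

/-- Smoothness of `f : A → B`, where `ι` and `κ` realize `A` and `B` as subsets of real normed
spaces: near each point of `A`, `f` is the restriction of a smooth map defined on an open set. -/
def IsSmooth {A B V W : Type*} [NormedAddCommGroup V] [NormedSpace ℝ V] [NormedAddCommGroup W]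
    [NormedSpace ℝ W] (ι : A → V) (κ : B → W) (f : A → B) : Prop :=
  ∀ a, ∃ (U : Set V) (G : V → W), IsOpen U ∧ ι a ∈ U ∧ ContDiffOn ℝ ∞ G U ∧
    ∀ a', ι a' ∈ U → G (ι a') = κ (f a')

/-- `f` is a bijection that is smooth in both directions. -/
def IsDiffeo {A B V W : Type*} [NormedAddCommGroup V] [NormedSpace ℝ V] [NormedAddCommGroup W]
    [NormedSpace ℝ W] (ι : A → V) (κ : B → W) (f : A → B) : Prop :=
  IsSmooth ι κ f ∧
    ∃ g : B → A, Function.LeftInverse g f ∧ Function.RightInverse g f ∧ IsSmooth κ ι g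

end Springer

end

/-! Let `L` be `z`-stable and contained in the range of `z`; a member `L_k` of a flag with `k < N`
is such a subspace, because it lies in `ker z^k`. Then `C` maps `z⁻¹L ∩ Lᗮ` isometrically onto `ℂ²`
(`norm_C`, `C_gapProj_CAdj`). So a subspace `L'` between `L` and `z⁻¹L` is the same thing as a
subspace of `ℂ²`, and `gap L L' = C (P_{L'} - P_L) C^*` is the orthogonal projection onto the
latter. Conversely, `P_{L'}` is a polynomial in `P_L` and `gap L L'` (`starProjection_eq_add`).
Building a flag one line at a time therefore inverts `φ`, and both directions are polynomial in the
projections, hence smooth.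

Three rules for `gap` govern the components: it is additive along chains, it is unchanged when `z⁻¹`
is applied to both arguments (`gap_comap`), and `gap L (z⁻¹L) = 1` (`gap_self_comap`). If `L_t =
z^{-k} L_{i+1}`, they show that passing from `L_t` to `z^{-(k+1)} L_i` adds the line orthogonal to
the `i`-th one. So closing an arc of the matching means that the lines at its two ends are
orthogonal (`flagSeq_eq_comap_iff`). The ends have opposite parity, so `I` turns orthogonality into
equality, which is the condition of `S_a`.

Every flag with `L_{2n} = ker z^n` lies in some `K_a`: a dimension count forces two consecutive
lines to be orthogonal (`exists_perp_succ`), deleting them leaves a flag of the same kind for `n -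
1` (`flagSeq_skip`), and induction supplies the matching. -/

noncomputable section

namespace Springer

/-! ### The adjoints of `z` and `C` -/

/-- The adjoint of `z`: the shift `e_j ↦ e_{j+1}`, `f_j ↦ f_{j+1}`. -/
def zAdj (N : ℕ) : E N →ₗ[ℂ] E N where
  toFun v := WithLp.toLp 2 fun p =>
    if 0 < (p.2 : ℕ) then v (p.1, ⟨(p.2 : ℕ) - 1, by omega⟩) else 0
  map_add' v w := by
    ext p
    by_cases h : 0 < (p.2 : ℕ) <;> simp [h]
  map_smul' c v := by
    ext p
    by_cases h : 0 < (p.2 : ℕ) <;> simp [h]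

/-- The adjoint of `C`. -/
def CAdj (N : ℕ) : C2 →ₗ[ℂ] E N where
  toFun w := WithLp.toLp 2 fun p => w p.1
  map_add' v w := by ext p; simp
  map_smul' c v := by ext p; simp

lemma zAdj_apply {N : ℕ} (v : E N) (p : Fin 2 × Fin N) :
    zAdj N v p = if 0 < (p.2 : ℕ) then v (p.1, ⟨(p.2 : ℕ) - 1, by omega⟩) else 0 := rfl

lemma CAdj_apply {N : ℕ} (w : C2) (p : Fin 2 × Fin N) : CAdj N w p = w p.1 := rfl

lemma inner_zAdj {N : ℕ} (v w : E N) : inner ℂ v (zAdj N w) = inner ℂ (z N v) w := by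
  obtain _ | M := N
  · rw [Subsingleton.elim v 0]; simp
  simp only [PiLp.inner_apply, Fintype.sum_prod_type]
  refine Finset.sum_congr rfl fun k _ => ?_
  rw [Fin.sum_univ_succ, Fin.sum_univ_castSucc]
  simp [z_apply, zAdj_apply, Fin.succ, Fin.castSucc, Fin.castAdd, Fin.castLE]

lemma inner_CAdj {N : ℕ} (v : E N) (w : C2) : inner ℂ v (CAdj N w) = inner ℂ (C N v) w := by
  simp only [PiLp.inner_apply, Fintype.sum_prod_type]
  refine Finset.sum_congr rfl fun k _ => ?_
  simp [C_apply, CAdj_apply, Finset.mul_sum]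

lemma mem_range_z {N : ℕ} {v : E N} :
    v ∈ LinearMap.range (z N) ↔ ∀ p : Fin 2 × Fin N, (p.2 : ℕ) + 1 = N → v p = 0 := by
  constructor
  · rintro ⟨w, rfl⟩ p hp
    rw [z_apply, dif_neg (by omega)]
  · intro h
    refine ⟨zAdj N v, ?_⟩
    ext p
    rw [z_apply]
    split_ifs with hp
    · simp [zAdj_apply]
    · exact (h p (by omega)).symm

lemma z_zAdj {N : ℕ} {v : E N} (hv : v ∈ LinearMap.range (z N)) : z N (zAdj N v) = v := by
  ext p
  rw [z_apply]
  split_ifs with hp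
  · simp [zAdj_apply]
  · exact (mem_range_z.1 hv p (by omega)).symm

/-- On the range of `z` the top coordinates vanish, so the shift loses none of the terms that `C`
adds up. -/
lemma C_zAdj {N : ℕ} {v : E N} (hv : v ∈ LinearMap.range (z N)) : C N (zAdj N v) = C N v := by
  obtain _ | M := N
  · rw [Subsingleton.elim v 0]; simp
  ext k
  rw [C_apply, C_apply, Fin.sum_univ_succ, Fin.sum_univ_castSucc,
    mem_range_z.1 hv (k, Fin.last M) (by simp)]
  simp [zAdj_apply, Fin.succ, Fin.castSucc, Fin.castAdd, Fin.castLE]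

/-- `1 - z^* z` is the projection onto `ker z`: it keeps only the coordinates of `e_1` and `f_1`. -/
lemma C_sub_zAdj_z_CAdj {N : ℕ} (hN : 0 < N) (w : C2) :
    C N (CAdj N w - zAdj N (z N (CAdj N w))) = w := by
  obtain _ | M := N
  · omega
  ext k
  rw [C_apply, Fin.sum_univ_succ]
  have (j : Fin M) : (j : ℕ) < M := j.2
  simp [zAdj_apply, z_apply, CAdj_apply]

lemma mem_ker_z_pow {N d : ℕ} {v : E N} :
    v ∈ LinearMap.ker (z N ^ d) ↔ ∀ p : Fin 2 × Fin N, d ≤ (p.2 : ℕ) → v p = 0 := by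
  rw [LinearMap.mem_ker]
  constructor
  · intro h p hp
    have := congrArg (fun u : E N => u (p.1, ⟨(p.2 : ℕ) - d, by omega⟩)) h
    simp only [z_pow_apply] at this
    rw [dif_pos (by omega)] at this
    simpa [Nat.sub_add_cancel hp] using this
  · intro h
    ext p
    rw [z_pow_apply]
    split_ifs with hp
    · exact h _ (by simp)
    · rfl

/-- This is how the lower bound on `N` puts the proper members of a flag inside the range of `z`. -/
lemma ker_z_pow_le_range {N d : ℕ} (h : d < N) :
    LinearMap.ker (z N ^ d) ≤ LinearMap.range (z N) := fun _ hv =>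
  mem_range_z.2 fun p hp => mem_ker_z_pow.1 hv p (by omega)

lemma En_eq_ker (N n : ℕ) : En N n = LinearMap.ker (z N ^ n) := by
  apply le_antisymm
  · rw [En, Submodule.span_le]
    rintro _ ⟨k, j, hj, rfl⟩
    refine mem_ker_z_pow.2 fun p hp => ?_
    rw [PiLp.single_apply, if_neg]
    rintro rfl
    simp at hp
    omega
  · intro v hv
    have hsum := (EuclideanSpace.basisFun (Fin 2 × Fin N) ℂ).sum_repr v
    rw [← hsum]
    refine Submodule.sum_mem _ fun p _ => ?_
    by_cases hp : (p.2 : ℕ) < n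
    · refine Submodule.smul_mem _ _ (Submodule.subset_span ⟨p.1, p.2, hp, ?_⟩)
      simp
    · have : v p = 0 := mem_ker_z_pow.1 hv p (by omega)
      simp [this]

/-! ### Stable subspaces -/

/-- `z L ⊆ L`. -/
def Stable {N : ℕ} (L : Submodule ℂ (E N)) : Prop := L ≤ L.comap (z N)

lemma stable_bot (N : ℕ) : Stable (⊥ : Submodule ℂ (E N)) := bot_le

lemma Stable.comap {N : ℕ} {L : Submodule ℂ (E N)} (hL : Stable L) : Stable (L.comap (z N)) :=
  Submodule.comap_mono hL

lemma comap_z_pow_zero {N : ℕ} (L : Submodule ℂ (E N)) : L.comap (z N ^ 0) = L := by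
  rw [pow_zero, Module.End.one_eq_id, Submodule.comap_id]

lemma comap_z_pow_succ {N : ℕ} (L : Submodule ℂ (E N)) (k : ℕ) :
    L.comap (z N ^ (k + 1)) = (L.comap (z N ^ k)).comap (z N) := by
  rw [pow_succ, Module.End.mul_eq_comp, Submodule.comap_comp]

lemma comap_z_pow_succ' {N : ℕ} (L : Submodule ℂ (E N)) (k : ℕ) :
    L.comap (z N ^ (k + 1)) = (L.comap (z N)).comap (z N ^ k) := by
  rw [pow_succ', Module.End.mul_eq_comp, Submodule.comap_comp]

lemma comap_z_pow_add {N : ℕ} (L : Submodule ℂ (E N)) (k l : ℕ) :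
    L.comap (z N ^ (k + l)) = (L.comap (z N ^ k)).comap (z N ^ l) := by
  rw [pow_add, Module.End.mul_eq_comp, Submodule.comap_comp]

lemma Stable.comap_pow {N : ℕ} {L : Submodule ℂ (E N)} (hL : Stable L) (k : ℕ) :
    Stable (L.comap (z N ^ k)) := by
  induction k with
  | zero => rwa [comap_z_pow_zero]
  | succ k ih => rw [comap_z_pow_succ]; exact ih.comap

lemma Stable.comap_pow_mono {N : ℕ} {L : Submodule ℂ (E N)} (hL : Stable L) :
    Monotone fun k : ℕ => L.comap (z N ^ k) :=
  monotone_nat_of_le_succ fun k => by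
    rw [comap_z_pow_succ]
    exact hL.comap_pow k

/-- The restriction of `C` to `z⁻¹ L ∩ Lᗮ` preserves norms. -/
lemma norm_C {N : ℕ} {L : Submodule ℂ (E N)} (hL : Stable L) {v : E N}
    (hv : z N v ∈ L) (hv' : v ∈ Lᗮ) : ‖C N v‖ = ‖v‖ := by
  obtain _ | M := N
  · rw [Subsingleton.elim v 0]; simp
  -- The geometric series satisfies `u = z u + v` with `z u ∈ L` orthogonal to `v`, so `‖u‖² = ‖z
  -- u‖² + ‖v‖²`. The shift `z` drops exactly the lowest coordinates of `u`, which form `C v`, so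
  -- also `‖u‖² = ‖C v‖² + ‖z u‖²`.
  set u : E (M + 1) := ∑ d ∈ Finset.range (M + 1), (z (M + 1) ^ d) v with hu
  have hst : ∀ d : ℕ, (z (M + 1) ^ (d + 1)) v ∈ L := by
    intro d
    induction d with
    | zero => simpa using hv
    | succ d ih =>
      rw [pow_succ', Module.End.mul_apply]
      exact hL ih
  have hzu : z (M + 1) u = ∑ d ∈ Finset.range (M + 1), (z (M + 1) ^ (d + 1)) v := by
    rw [hu, map_sum]
    exact Finset.sum_congr rfl fun d _ => by rw [pow_succ', Module.End.mul_apply]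
  have hmem : z (M + 1) u ∈ L := hzu ▸ Submodule.sum_mem _ fun d _ => hst d
  have huv : u = z (M + 1) u + v := by
    rw [hzu, Finset.sum_range_succ, z_pow_eq_zero, LinearMap.zero_apply, add_zero, hu,
      Finset.sum_range_succ', pow_zero, Module.End.one_apply]
  have hu0 : ∀ k, u (k, 0) = C (M + 1) v k := by
    intro k
    rw [C_apply, hu, WithLp.ofLp_sum, Finset.sum_apply, Finset.sum_range]
    refine Finset.sum_congr rfl fun d _ => ?_
    rw [z_pow_apply, dif_pos (by simpa using d.is_le)]
    simp
  have hnorm : ‖u‖ ^ 2 = ‖C (M + 1) v‖ ^ 2 + ‖z (M + 1) u‖ ^ 2 := by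
    rw [EuclideanSpace.norm_sq_eq, EuclideanSpace.norm_sq_eq, EuclideanSpace.norm_sq_eq,
      Fintype.sum_prod_type, Fintype.sum_prod_type, ← Finset.sum_add_distrib]
    refine Finset.sum_congr rfl fun k _ => ?_
    rw [Fin.sum_univ_succ, Fin.sum_univ_castSucc, hu0]
    simp [z_apply, Fin.succ]
  have hin : inner ℂ (z (M + 1) u) v = 0 := Submodule.inner_right_of_mem_orthogonal hmem hv'
  have hadd := @norm_add_sq ℂ _ _ _ _ (z (M + 1) u) v
  rw [← huv, hin, hnorm] at hadd
  have : ‖C (M + 1) v‖ ^ 2 = ‖v‖ ^ 2 := by simpa [add_comm] using hadd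
  exact (sq_eq_sq₀ (norm_nonneg _) (norm_nonneg _)).1 this

lemma eq_zero_of_C_eq_zero {N : ℕ} {L : Submodule ℂ (E N)} (hL : Stable L) {v : E N}
    (hv : v ∈ L.comap (z N) ⊓ Lᗮ) (h : C N v = 0) : v = 0 := by
  have := norm_C hL hv.1 hv.2
  rw [h, norm_zero] at this
  exact norm_eq_zero.1 this.symm

lemma finrank_map_C {N : ℕ} {L D : Submodule ℂ (E N)} (hL : Stable L)
    (hD : D ≤ L.comap (z N) ⊓ Lᗮ) : Module.finrank ℂ (D.map (C N)) = Module.finrank ℂ D := by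
  refine (LinearEquiv.finrank_eq (LinearEquiv.ofBijective
    ((C N).submoduleMap D) ⟨?_, LinearMap.submoduleMap_surjective _ _⟩)).symm
  rw [injective_iff_map_eq_zero]
  rintro ⟨v, hv⟩ h
  exact Subtype.ext (eq_zero_of_C_eq_zero hL (hD hv) (congrArg Subtype.val h))

lemma finrank_comap_z_le {N : ℕ} {L : Submodule ℂ (E N)} (hL : Stable L) :
    Module.finrank ℂ (L.comap (z N)) ≤ Module.finrank ℂ L + 2 := by
  have h1 := Submodule.finrank_add_inf_finrank_orthogonal hL
  rw [inf_comm, ← finrank_map_C hL le_rfl] at h1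
  have h2 := Submodule.finrank_le ((L.comap (z N) ⊓ Lᗮ).map (C N))
  rw [finrank_euclideanSpace_fin] at h2
  omega

lemma finrank_comap_z_pow_le {N : ℕ} {L : Submodule ℂ (E N)} (hL : Stable L) (k : ℕ) :
    Module.finrank ℂ (L.comap (z N ^ k)) ≤ Module.finrank ℂ L + 2 * k := by
  induction k with
  | zero => rw [comap_z_pow_zero]; simp
  | succ k ih =>
    rw [comap_z_pow_succ]
    have := finrank_comap_z_le (hL.comap_pow k)
    omega

/-! ### Orthogonal projections -/

lemma starProjection_sub {V : Type*} [NormedAddCommGroup V] [InnerProductSpace ℂ V]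
    [FiniteDimensional ℂ V] {L L' : Submodule ℂ V} (h : L ≤ L') (v : V) :
    L'.starProjection v - L.starProjection v = (L' ⊓ Lᗮ).starProjection v := by
  symm
  refine Submodule.eq_starProjection_of_mem_orthogonal (Submodule.mem_inf.2 ⟨?_, ?_⟩) ?_
  · exact sub_mem (Submodule.starProjection_apply_mem _ _)
      (h (Submodule.starProjection_apply_mem _ _))
  · have h1 := Submodule.sub_starProjection_mem_orthogonal (K := L) v
    have h2 := Submodule.orthogonal_le h (Submodule.sub_starProjection_mem_orthogonal (K := L') v)
    simpa using sub_mem h1 h2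
  · have h1 := Submodule.sub_starProjection_mem_orthogonal (K := L') v
    rw [← sub_add]
    refine add_mem (Submodule.orthogonal_le inf_le_left h1) ?_
    exact Submodule.orthogonal_le inf_le_right
      (Submodule.le_orthogonal_orthogonal _ (Submodule.starProjection_apply_mem _ _))

/-- The formula is `1 - z^* (1 - P_L) z`. It is correct because `z z^*` is the identity on the range
of `z`, and `z^*` maps `Lᗮ` into the complement of `z⁻¹L`. -/
lemma starProjection_comap_z {N : ℕ} {L : Submodule ℂ (E N)} (hr : L ≤ LinearMap.range (z N))
    (v : E N) : (L.comap (z N)).starProjection v =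
      v - zAdj N (z N v) + zAdj N (L.starProjection (z N v)) := by
  refine Submodule.eq_starProjection_of_mem_of_inner_eq_zero ?_ ?_
  · have hP := Submodule.starProjection_apply_mem L (z N v)
    rw [Submodule.mem_comap, map_add, map_sub, z_zAdj (LinearMap.mem_range_self _ v),
      z_zAdj (hr hP), sub_self, zero_add]
    exact hP
  · intro w hw
    have h1 : v - (v - zAdj N (z N v) + zAdj N (L.starProjection (z N v))) =
        zAdj N (z N v - L.starProjection (z N v)) := by
      rw [map_sub]; abel
    rw [h1, ← inner_conj_symm, inner_zAdj]
    rw [Submodule.inner_right_of_mem_orthogonal (K := L) hw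
      (Submodule.sub_starProjection_mem_orthogonal _), map_zero]

/-! ### The gap operator and its calculus -/

/-- The operator `C (P_{L'} - P_L) C^*` on `ℂ²`. -/
def gap {N : ℕ} (L L' : Submodule ℂ (E N)) : C2 →L[ℂ] C2 :=
  (C N).toContinuousLinearMap ∘L (L'.starProjection - L.starProjection) ∘L
    (CAdj N).toContinuousLinearMap

lemma gap_apply {N : ℕ} (L L' : Submodule ℂ (E N)) (w : C2) :
    gap L L' w = C N (L'.starProjection (CAdj N w) - L.starProjection (CAdj N w)) := rfl

lemma gap_add_gap {N : ℕ} (L L' L'' : Submodule ℂ (E N)) :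
    gap L L' + gap L' L'' = gap L L'' := by
  ext1 w
  rw [add_apply, gap_apply, gap_apply, gap_apply, ← map_add]
  congr 1
  abel

/-- `C z^* = C` on `L` removes the outer `z^*`. The adjoint of the same identity gives `P_L z C^* =
P_L C^*`. -/
lemma C_zAdj_starProjection_z {N : ℕ} {L : Submodule ℂ (E N)}
    (hr : L ≤ LinearMap.range (z N)) (w : C2) :
    C N (zAdj N (L.starProjection (z N (CAdj N w)))) = C N (L.starProjection (CAdj N w)) := by
  rw [C_zAdj (hr (Submodule.starProjection_apply_mem _ _))]
  congr 1
  refine (Submodule.eq_starProjection_of_mem_of_inner_eq_zero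
    (Submodule.starProjection_apply_mem _ _) fun x hx => ?_).symm
  have h1 : inner ℂ x (CAdj N w) = inner ℂ x (z N (CAdj N w)) := by
    have h2 : inner ℂ (zAdj N x) (CAdj N w) = inner ℂ x (z N (CAdj N w)) := by
      rw [← inner_conj_symm, inner_zAdj, inner_conj_symm]
    rw [← h2, inner_CAdj, inner_CAdj, C_zAdj (hr hx)]
  have h3 := Submodule.inner_right_of_mem_orthogonal hx
    (Submodule.sub_starProjection_mem_orthogonal (K := L) (z N (CAdj N w)))
  rw [inner_sub_right] at h3
  rw [← inner_conj_symm, inner_sub_right, h1, h3, map_zero]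

lemma gap_comap {N : ℕ} {L L' : Submodule ℂ (E N)} (hr : L ≤ LinearMap.range (z N))
    (hr' : L' ≤ LinearMap.range (z N)) :
    gap (L.comap (z N)) (L'.comap (z N)) = gap L L' := by
  ext1 w
  rw [gap_apply, gap_apply, starProjection_comap_z hr, starProjection_comap_z hr',
    add_sub_add_left_eq_sub, map_sub, map_sub, C_zAdj_starProjection_z hr,
    C_zAdj_starProjection_z hr']

lemma gap_self_comap {N : ℕ} (hN : 0 < N) {L : Submodule ℂ (E N)}
    (hr : L ≤ LinearMap.range (z N)) : gap L (L.comap (z N)) = 1 := by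
  ext1 w
  rw [gap_apply, starProjection_comap_z hr, map_sub, map_add, C_zAdj_starProjection_z hr,
    C_sub_zAdj_z_CAdj hN]
  simp

/-- The orthogonal projection onto `z⁻¹ L ∩ Lᗮ`. -/
abbrev gapProj {N : ℕ} (L : Submodule ℂ (E N)) : E N →L[ℂ] E N :=
  (L.comap (z N) ⊓ Lᗮ).starProjection

lemma C_gapProj_CAdj {N : ℕ} (hN : 0 < N) {L : Submodule ℂ (E N)} (hL : Stable L)
    (hr : L ≤ LinearMap.range (z N)) (w : C2) : C N (gapProj L (CAdj N w)) = w := by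
  rw [gapProj, ← starProjection_sub hL, ← gap_apply, gap_self_comap hN hr]
  rfl

/-- The right inverse of `C` on `z⁻¹L ∩ Lᗮ` is also a left inverse, since `C` is injective there. -/
lemma gapProj_CAdj_C {N : ℕ} (hN : 0 < N) {L : Submodule ℂ (E N)} (hL : Stable L)
    (hr : L ≤ LinearMap.range (z N)) {v : E N} (hv : v ∈ L.comap (z N) ⊓ Lᗮ) :
    gapProj L (CAdj N (C N v)) = v := by
  rw [← sub_eq_zero]
  refine eq_zero_of_C_eq_zero hL (sub_mem (Submodule.starProjection_apply_mem _ _) hv) ?_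
  rw [map_sub, C_gapProj_CAdj hN hL hr, sub_self]

lemma gap_eq_C_starProjection {N : ℕ} {L L' : Submodule ℂ (E N)} (h : L ≤ L') (w : C2) :
    gap L L' w = C N ((L' ⊓ Lᗮ).starProjection (CAdj N w)) := by
  rw [gap_apply, starProjection_sub h]

/-- The projection onto `L'` is determined by the one onto `L` and by `gap L L'`. -/
lemma starProjection_eq_add {N : ℕ} (hN : 0 < N) {L L' : Submodule ℂ (E N)} (hL : Stable L)
    (hr : L ≤ LinearMap.range (z N)) (h : L ≤ L') (h' : L' ≤ L.comap (z N)) (v : E N) :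
    L'.starProjection v =
      L.starProjection v + gapProj L (CAdj N (gap L L' (C N (gapProj L v)))) := by
  have hle : L' ⊓ Lᗮ ≤ L.comap (z N) ⊓ Lᗮ := inf_le_inf_right _ h'
  -- Write `P` for the projection onto `L' ⊓ Lᗮ` and `R` for `gapProj L`. As `R C^* C` is the
  -- identity on the range of `P`, the claim reduces to `P C^* C R = P`, the adjoint of `R C^* C P =
  -- P`.
  rw [gap_eq_C_starProjection h,
    gapProj_CAdj_C hN hL hr (hle (Submodule.starProjection_apply_mem _ _)), ← sub_eq_iff_eq_add',
    starProjection_sub h]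
  refine (Submodule.eq_starProjection_of_mem_of_inner_eq_zero
    (Submodule.starProjection_apply_mem _ _) fun x hx => ?_).symm
  set R := gapProj L
  have hsym (a b : E N) : inner ℂ a (R b) = inner ℂ (R a) b :=
    (Submodule.inner_starProjection_left_eq_right _ a b).symm
  have hRx : R x = x := Submodule.starProjection_eq_self_iff.2 (hle hx)
  have h1 (y : E N) : inner ℂ x ((L' ⊓ Lᗮ).starProjection y) = inner ℂ x y := by
    rw [← Submodule.inner_starProjection_left_eq_right, Submodule.starProjection_eq_self_iff.2 hx]
  rw [← inner_conj_symm, inner_sub_right, h1, inner_CAdj, ← inner_conj_symm (C N x),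
    ← inner_CAdj, inner_conj_symm]
  have h2 : inner ℂ (CAdj N (C N x)) (R v) = inner ℂ x v := by
    rw [hsym, gapProj_CAdj_C hN hL hr (hle hx)]
  rw [h2, sub_self, map_zero]

lemma eq_of_gap_eq {N : ℕ} (hN : 0 < N) {L L' L'' : Submodule ℂ (E N)} (hL : Stable L)
    (hr : L ≤ LinearMap.range (z N)) (h : L ≤ L') (h' : L' ≤ L.comap (z N))
    (k : L ≤ L'') (k' : L'' ≤ L.comap (z N)) (hg : gap L L' = gap L L'') : L' = L'' := by
  rw [← Submodule.starProjection_inj]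
  ext1 v
  rw [starProjection_eq_add hN hL hr h h', starProjection_eq_add hN hL hr k k', hg]

/-- `C` preserves inner products on `z⁻¹L ∩ Lᗮ`, so it carries the projection onto `D` to the
projection onto the image of `D`. -/
lemma starProjection_map_C {N : ℕ} (hN : 0 < N) {L D : Submodule ℂ (E N)} (hL : Stable L)
    (hr : L ≤ LinearMap.range (z N)) (hD : D ≤ L.comap (z N) ⊓ Lᗮ) (w : C2) :
    (D.map (C N)).starProjection w = C N (D.starProjection (CAdj N w)) := by
  refine Submodule.eq_starProjection_of_mem_of_inner_eq_zero
    (Submodule.mem_map_of_mem (Submodule.starProjection_apply_mem _ _)) ?_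
  rintro _ ⟨x, hx, rfl⟩
  have hy := Submodule.starProjection_apply_mem D (CAdj N w)
  have hsym (a b : E N) : inner ℂ a (gapProj L b) = inner ℂ (gapProj L a) b :=
    (Submodule.inner_starProjection_left_eq_right _ a b).symm
  have h1 (y : E N) (hy : y ∈ D) : inner ℂ (C N x) (C N y) = inner ℂ x y := by
    rw [← inner_CAdj]
    conv_lhs => rw [← Submodule.starProjection_eq_self_iff.2 (hD hx)]
    rw [← hsym, gapProj_CAdj_C hN hL hr (hD hy)]
  rw [← inner_conj_symm, inner_sub_right, h1 _ hy, ← inner_CAdj,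
    ← Submodule.inner_starProjection_left_eq_right, Submodule.starProjection_eq_self_iff.2 hx,
    sub_self, map_zero]

lemma gap_eq_starProjection {N : ℕ} (hN : 0 < N) {L L' : Submodule ℂ (E N)} (hL : Stable L)
    (hr : L ≤ LinearMap.range (z N)) (h : L ≤ L') (h' : L' ≤ L.comap (z N)) :
    gap L L' = ((L' ⊓ Lᗮ).map (C N)).starProjection := by
  ext1 w
  rw [starProjection_map_C hN hL hr (inf_le_inf_right _ h'), gap_eq_C_starProjection h]

/-! ### Lines in `ℂ²` -/

/-- The orthogonal projection onto a line in `ℂ²`. -/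
abbrev linePr (l : P1) : C2 →L[ℂ] C2 := l.submodule.starProjection

lemma linePr_injective : Function.Injective linePr := fun _ _ h =>
  Projectivization.submodule_injective (Submodule.starProjection_inj.1 h)

lemma linePr_mk'' (H : Submodule ℂ C2) (h : Module.finrank ℂ H = 1) :
    linePr (Projectivization.mk'' H h) = H.starProjection :=
  Submodule.starProjection_inj.2 (Projectivization.submodule_mk'' H h)

lemma linePr_perp (l : P1) : linePr (perp l) = 1 - linePr l := by
  rw [perp, linePr_mk'', Submodule.starProjection_orthogonal']

lemma perp_perp (l : P1) : perp (perp l) = l :=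
  linePr_injective (by rw [linePr_perp, linePr_perp, sub_sub_cancel])

/-- The `k`-th component of `I`, the components being numbered from `0`. -/
def twist (k : ℕ) (l : P1) : P1 := if Even (k + 1) then perp l else l

lemma twist_twist (k : ℕ) (l : P1) : twist k (twist k l) = l := by
  unfold twist
  split_ifs <;> simp [perp_perp]

/-- Exactly one of the two positions is complemented. This is what turns orthogonality at the ends
of an arc into the equality defining `S_a`. -/
lemma twist_eq_twist_iff {i j : ℕ} (h : Odd (i + j)) (l l' : P1) :
    twist i l = twist j l' ↔ l' = perp l := by
  unfold twist
  by_cases hi : Even (i + 1)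
  · rw [if_pos hi, if_neg (by grind)]
    exact eq_comm
  · rw [if_neg hi, if_pos (by grind)]
    constructor
    · rintro rfl
      rw [perp_perp]
    · rintro rfl
      rw [perp_perp]

/-! ### Extending a stable subspace by a line -/

/-- The extension of `L` by the subspace of `z⁻¹ L ∩ Lᗮ` that `C` maps to `l`. -/
def step {N : ℕ} (L : Submodule ℂ (E N)) (l : Submodule ℂ C2) : Submodule ℂ (E N) :=
  L.comap (z N) ⊓ Lᗮ ⊓ l.comap (C N) ⊔ L

lemma le_step {N : ℕ} (L : Submodule ℂ (E N)) (l : Submodule ℂ C2) : L ≤ step L l := le_sup_right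

lemma step_le_comap {N : ℕ} {L : Submodule ℂ (E N)} (hL : Stable L) (l : Submodule ℂ C2) :
    step L l ≤ L.comap (z N) :=
  sup_le (inf_le_left.trans inf_le_left) hL

lemma step_inf_orthogonal {N : ℕ} (L : Submodule ℂ (E N)) (l : Submodule ℂ C2) :
    step L l ⊓ Lᗮ = L.comap (z N) ⊓ Lᗮ ⊓ l.comap (C N) := by
  have h : L.comap (z N) ⊓ Lᗮ ⊓ l.comap (C N) ≤ Lᗮ := inf_le_left.trans inf_le_right
  rw [step, sup_inf_assoc_of_le _ h, Submodule.inf_orthogonal_eq_bot, sup_bot_eq]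

lemma map_C_step {N : ℕ} (hN : 0 < N) {L : Submodule ℂ (E N)} (hL : Stable L)
    (hr : L ≤ LinearMap.range (z N)) (l : Submodule ℂ C2) :
    (step L l ⊓ Lᗮ).map (C N) = l := by
  rw [step_inf_orthogonal]
  apply le_antisymm
  · rw [Submodule.map_le_iff_le_comap]
    exact inf_le_right
  · intro w hw
    have hC := C_gapProj_CAdj hN hL hr w
    exact ⟨gapProj L (CAdj N w), ⟨Submodule.starProjection_apply_mem _ _,
      by rwa [← hC] at hw⟩, hC⟩

lemma finrank_step {N : ℕ} (hN : 0 < N) {L : Submodule ℂ (E N)} (hL : Stable L)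
    (hr : L ≤ LinearMap.range (z N)) (l : Submodule ℂ C2) :
    Module.finrank ℂ (step L l) = Module.finrank ℂ L + Module.finrank ℂ l := by
  have h := Submodule.finrank_add_inf_finrank_orthogonal (le_step L l)
  rw [inf_comm, ← finrank_map_C hL (inf_le_inf_right _ (step_le_comap hL l)),
    map_C_step hN hL hr] at h
  exact h.symm

lemma gap_step {N : ℕ} (hN : 0 < N) {L : Submodule ℂ (E N)} (hL : Stable L)
    (hr : L ≤ LinearMap.range (z N)) (l : Submodule ℂ C2) :
    gap L (step L l) = l.starProjection := by
  rw [gap_eq_starProjection hN hL hr (le_step L l) (step_le_comap hL l)]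
  congr 1
  exact map_C_step hN hL hr l

/-! ### The flag determined by a sequence of lines -/

/-- The flag whose successive lines `C(L_{k+1} ∩ L_kᗮ)` are the `y k`. -/
def flagSeq (N : ℕ) (y : ℕ → P1) : ℕ → Submodule ℂ (E N)
  | 0 => ⊥
  | k + 1 => step (flagSeq N y k) (y k).submodule

lemma flagSeq_le_succ (N : ℕ) (y : ℕ → P1) (k : ℕ) : flagSeq N y k ≤ flagSeq N y (k + 1) :=
  le_step _ _

lemma flagSeq_mono (N : ℕ) (y : ℕ → P1) : Monotone (flagSeq N y) :=
  monotone_nat_of_le_succ (flagSeq_le_succ N y)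

lemma flagSeq_stable (N : ℕ) (y : ℕ → P1) (k : ℕ) : Stable (flagSeq N y k) := by
  induction k with
  | zero => exact stable_bot N
  | succ k ih =>
    exact (step_le_comap ih _).trans (Submodule.comap_mono (flagSeq_le_succ N y k))

lemma flagSeq_succ_le_comap (N : ℕ) (y : ℕ → P1) (k : ℕ) :
    flagSeq N y (k + 1) ≤ (flagSeq N y k).comap (z N) :=
  step_le_comap (flagSeq_stable N y k) _

lemma flagSeq_le_ker (N : ℕ) (y : ℕ → P1) (k : ℕ) :
    flagSeq N y k ≤ LinearMap.ker (z N ^ k) := by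
  induction k with
  | zero => exact bot_le
  | succ k ih =>
    refine (flagSeq_succ_le_comap N y k).trans ((Submodule.comap_mono ih).trans ?_)
    rw [LinearMap.ker, LinearMap.ker, ← comap_z_pow_succ]

lemma flagSeq_le_range {N : ℕ} (y : ℕ → P1) {k : ℕ} (hk : k < N) :
    flagSeq N y k ≤ LinearMap.range (z N) :=
  (flagSeq_le_ker N y k).trans (ker_z_pow_le_range hk)

lemma finrank_flagSeq {N : ℕ} (y : ℕ → P1) {k : ℕ} (hk : k ≤ N) :
    Module.finrank ℂ (flagSeq N y k) = k := by
  induction k with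
  | zero => exact finrank_bot ℂ (E N)
  | succ k ih =>
    rw [flagSeq, finrank_step (by omega) (flagSeq_stable N y k) (flagSeq_le_range y hk),
      ih (by omega), Projectivization.finrank_submodule]

lemma gap_flagSeq {N : ℕ} (y : ℕ → P1) {k : ℕ} (hk : k < N) :
    gap (flagSeq N y k) (flagSeq N y (k + 1)) = linePr (y k) :=
  gap_step (by omega) (flagSeq_stable N y k) (flagSeq_le_range y hk) _

lemma eq_flagSeq_succ {N : ℕ} (y : ℕ → P1) {k : ℕ} (hk : k < N) {L : Submodule ℂ (E N)}
    (h : flagSeq N y k ≤ L) (h' : L ≤ (flagSeq N y k).comap (z N))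
    (hg : gap (flagSeq N y k) L = linePr (y k)) : L = flagSeq N y (k + 1) :=
  eq_of_gap_eq (by omega) (flagSeq_stable N y k) (flagSeq_le_range y hk) h h'
    (flagSeq_le_succ N y k) (flagSeq_succ_le_comap N y k) (hg.trans (gap_flagSeq y hk).symm)

lemma flagSeq_congr (N : ℕ) {y y' : ℕ → P1} {k : ℕ} (h : ∀ i < k, y i = y' i) :
    flagSeq N y k = flagSeq N y' k := by
  induction k with
  | zero => rfl
  | succ k ih => rw [flagSeq, flagSeq, ih fun i hi => h i (by omega), h k (by omega)]

/-! ### Flags in `Y` as sequences of lines, and the inverse of `I ∘ φ` -/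

lemma Y.L_zero {N m : ℕ} (F : Y N m) : F.L 0 = ⊥ :=
  Submodule.finrank_eq_zero.1 (by simpa using F.finrank_eq 0)

lemma Y.castSucc_le_succ {N m : ℕ} (F : Y N m) (j : Fin m) : F.L j.castSucc ≤ F.L j.succ :=
  F.strictMono.monotone (Fin.castSucc_lt_succ).le

lemma Y.succ_le_comap {N m : ℕ} (F : Y N m) (j : Fin m) :
    F.L j.succ ≤ (F.L j.castSucc).comap (z N) := fun _ hv => F.z_mem j hv

lemma Y.stable' {N m : ℕ} (F : Y N m) (j : Fin (m + 1)) : Stable (F.L j) :=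
  Submodule.map_le_iff_le_comap.1 (F.stable j)

lemma Y.le_ker {N m : ℕ} (F : Y N m) (j : Fin (m + 1)) :
    F.L j ≤ LinearMap.ker (z N ^ (j : ℕ)) := by
  induction j using Fin.induction with
  | zero => rw [F.L_zero]; exact bot_le
  | succ j ih =>
    refine (F.succ_le_comap j).trans ((Submodule.comap_mono ih).trans ?_)
    rw [LinearMap.ker, LinearMap.ker, ← comap_z_pow_succ]
    rfl

lemma Y.le_range {N m : ℕ} (hm : m ≤ N) (F : Y N m) (j : Fin m) :
    F.L j.castSucc ≤ LinearMap.range (z N) :=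
  (F.le_ker _).trans (ker_z_pow_le_range (by have := j.2; simp; omega))

lemma linePr_phi {N m : ℕ} (hm : m ≤ N) (F : Y N m) (j : Fin m) :
    linePr (phi N m F j) = gap (F.L j.castSucc) (F.L j.succ) := by
  rw [gap_eq_starProjection (by have := j.2; omega) (F.stable' _) (F.le_range hm j)
    (F.castSucc_le_succ j) (F.succ_le_comap j), phi, linePr_mk'']

lemma Y.L_eq_flagSeq {N m : ℕ} (hm : m ≤ N) (F : Y N m) {y : ℕ → P1}
    (hy : ∀ j : Fin m, y j = phi N m F j) (j : Fin (m + 1)) : F.L j = flagSeq N y j := by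
  induction j using Fin.induction with
  | zero => rw [F.L_zero]; rfl
  | succ j ih =>
    rw [Fin.val_succ]
    rw [Fin.val_castSucc] at ih
    refine eq_flagSeq_succ y (by omega) ?_ ?_ ?_
    · rw [← ih]; exact F.castSucc_le_succ j
    · rw [← ih]; exact F.succ_le_comap j
    · rw [← ih, hy, linePr_phi hm]

/-- The first `m` steps of `flagSeq`. -/
def flagOf {N m : ℕ} (hm : m ≤ N) (y : ℕ → P1) : Y N m where
  L j := flagSeq N y j
  strictMono i j hij := by
    refine lt_of_le_of_ne (flagSeq_mono N y hij.le) fun h => ?_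
    have := congrArg (fun L : Submodule ℂ (E N) => Module.finrank ℂ L) h
    simp only at this
    rw [finrank_flagSeq y (by omega), finrank_flagSeq y (by omega)] at this
    exact hij.ne (Fin.ext this)
  finrank_eq j := finrank_flagSeq y (by omega)
  stable j := Submodule.map_le_iff_le_comap.2 (flagSeq_stable N y j)

lemma phi_flagOf {N m : ℕ} (hm : m ≤ N) (y : ℕ → P1) (j : Fin m) :
    phi N m (flagOf hm y) j = y j :=
  linePr_injective ((linePr_phi hm _ j).trans (gap_flagSeq y (j.2.trans_le hm)))

/-- Extension of a finite sequence of lines by an arbitrary line. -/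
def extend {m : ℕ} (l : Fin m → P1) (k : ℕ) : P1 :=
  if h : k < m then l ⟨k, h⟩ else Classical.arbitrary P1

lemma extend_val {m : ℕ} (l : Fin m → P1) (j : Fin m) : extend l j = l j := by
  simp [extend]

lemma I_apply (m : ℕ) (l : Fin m → P1) (j : Fin m) : I m l j = twist j (l j) := rfl

/-- The inverse of `I ∘ φ`. -/
def flagInv {N m : ℕ} (hm : m ≤ N) (l : Fin m → P1) : Y N m := flagOf hm (extend (I m l))

lemma I_phi_flagInv {N m : ℕ} (hm : m ≤ N) (l : Fin m → P1) :
    I m (phi N m (flagInv hm l)) = l := by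
  ext1 j
  rw [I_apply, flagInv, phi_flagOf, extend_val, I_apply, twist_twist]

lemma flagInv_I_phi {N m : ℕ} (hm : m ≤ N) (F : Y N m) :
    flagInv hm (I m (phi N m F)) = F := by
  ext1
  ext1 j
  refine (F.L_eq_flagSeq hm (fun i => ?_) j).symm
  rw [extend_val, I_apply, I_apply, twist_twist]

/-! ### Smoothness -/

/-- Both maps extend to complex polynomial maps on the whole space of operators, so a single global
extension replaces the local ones. -/
lemma IsSmooth.of_contDiff {A B V W : Type*} [NormedAddCommGroup V] [NormedSpace ℝ V]
    [NormedSpace ℂ V] [IsScalarTower ℝ ℂ V] [NormedAddCommGroup W] [NormedSpace ℝ W]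
    [NormedSpace ℂ W] [IsScalarTower ℝ ℂ W] {ι : A → V} {κ : B → W} {f : A → B} {G : V → W}
    (hG : ContDiff ℂ ∞ G) (h : ∀ a, G (ι a) = κ (f a)) : IsSmooth ι κ f := fun _ =>
  ⟨Set.univ, G, isOpen_univ, Set.mem_univ _, (hG.restrict_scalars ℝ).contDiffOn, fun a _ => h a⟩

/-- The effect of `twist` on projections. -/
def twistPr (k : ℕ) (Q : C2 →L[ℂ] C2) : C2 →L[ℂ] C2 := if Even (k + 1) then 1 - Q else Q

lemma linePr_twist (k : ℕ) (l : P1) : linePr (twist k l) = twistPr k (linePr l) := by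
  unfold twist twistPr
  split_ifs
  · exact linePr_perp l
  · rfl

lemma contDiff_twistPr (k : ℕ) : ContDiff ℂ ∞ (twistPr k) := by
  unfold twistPr
  split_ifs
  · exact contDiff_const.sub contDiff_id
  · exact contDiff_id

lemma isSmooth_I_phi {N m : ℕ} (hm : m ≤ N) :
    IsSmooth (flagProj N m) (lineProj m) (I m ∘ phi N m) := by
  refine IsSmooth.of_contDiff (G := fun P j => twistPr j ((C N).toContinuousLinearMap ∘L
    (P j.succ - P j.castSucc) ∘L (CAdj N).toContinuousLinearMap)) ?_ fun F => ?_
  · refine contDiff_pi.2 fun j => (contDiff_twistPr j).comp ?_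
    refine contDiff_const.clm_comp (ContDiff.clm_comp ?_ contDiff_const)
    exact (contDiff_apply ℂ _ _).sub (contDiff_apply ℂ _ _)
  · ext1 j
    exact (congrArg (twistPr j) (linePr_phi hm F j).symm).trans (linePr_twist _ _).symm

/-- The polynomial expression for the projection onto `z⁻¹ L ∩ Lᗮ` in terms of the one onto `L`. -/
def gapPoly (N : ℕ) (P : E N →L[ℂ] E N) : E N →L[ℂ] E N :=
  1 - (zAdj N).toContinuousLinearMap ∘L (z N).toContinuousLinearMap +
    (zAdj N).toContinuousLinearMap ∘L P ∘L (z N).toContinuousLinearMap - P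

lemma gapPoly_starProjection {N : ℕ} {L : Submodule ℂ (E N)} (hL : Stable L)
    (hr : L ≤ LinearMap.range (z N)) : gapPoly N L.starProjection = gapProj L := by
  ext1 v
  rw [gapProj, ← starProjection_sub hL, starProjection_comap_z hr]
  rfl

/-- The polynomial expression for the projection onto `step L l`. -/
def stepPoly (N : ℕ) (P : E N →L[ℂ] E N) (Q : C2 →L[ℂ] C2) : E N →L[ℂ] E N :=
  P + gapPoly N P ∘L (CAdj N).toContinuousLinearMap ∘L Q ∘L (C N).toContinuousLinearMap ∘L
    gapPoly N P

/-- The projections onto the members of a flag as polynomials in the projections onto lines. -/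
def flagPoly (N : ℕ) {m : ℕ} (Q : Fin m → (C2 →L[ℂ] C2)) : ℕ → (E N →L[ℂ] E N)
  | 0 => 0
  | k + 1 => stepPoly N (flagPoly N Q k) (if h : k < m then twistPr k (Q ⟨k, h⟩) else 0)

lemma contDiff_gapPoly (N : ℕ) : ContDiff ℂ ∞ (gapPoly N) := by
  unfold gapPoly
  exact (contDiff_const.add (contDiff_const.clm_comp
    (contDiff_id.clm_comp contDiff_const))).sub contDiff_id

lemma contDiff_flagPoly (N m k : ℕ) :
    ContDiff ℂ ∞ fun Q : Fin m → (C2 →L[ℂ] C2) => flagPoly N Q k := by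
  induction k with
  | zero => exact contDiff_const
  | succ k ih =>
    have hR := (contDiff_gapPoly N).comp ih
    have hQ : ContDiff ℂ ∞ fun Q : Fin m → (C2 →L[ℂ] C2) =>
        if h : k < m then twistPr k (Q ⟨k, h⟩) else 0 := by
      split_ifs with h
      · exact (contDiff_twistPr k).comp (contDiff_apply ℂ _ _)
      · exact contDiff_const
    exact ih.add (hR.clm_comp (contDiff_const.clm_comp
      (hQ.clm_comp (contDiff_const.clm_comp hR))))

lemma flagPoly_lineProj {N m : ℕ} (hm : m ≤ N) (l : Fin m → P1) {k : ℕ} (hk : k ≤ m) :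
    flagPoly N (lineProj m l) k = (flagSeq N (extend (I m l)) k).starProjection := by
  induction k with
  | zero => exact Submodule.starProjection_bot.symm
  | succ k ih =>
    set y := extend (I m l) with hy
    have hkN : k < N := by omega
    have hkm : k < m := hk
    have hQ : twistPr k (lineProj m l ⟨k, hkm⟩) = linePr (y k) := by
      have : y k = twist k (l ⟨k, hkm⟩) := by
        rw [← I_apply m l ⟨k, hkm⟩]
        exact extend_val (I m l) ⟨k, hkm⟩
      rw [this, linePr_twist]
      rfl
    rw [flagPoly, dif_pos hkm, ih (by omega), stepPoly,
      gapPoly_starProjection (flagSeq_stable N y k) (flagSeq_le_range y hkN), hQ,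
      ← gap_flagSeq y hkN]
    ext1 v
    exact (starProjection_eq_add (by omega) (flagSeq_stable N y k) (flagSeq_le_range y hkN)
      (flagSeq_le_succ N y k) (flagSeq_succ_le_comap N y k) v).symm

lemma isSmooth_flagInv {N m : ℕ} (hm : m ≤ N) :
    IsSmooth (lineProj m) (flagProj N m) (flagInv hm) := by
  refine IsSmooth.of_contDiff (G := fun Q j => flagPoly N Q j)
    (contDiff_pi.2 fun j => contDiff_flagPoly N m j) fun l => ?_
  ext1 j
  exact flagPoly_lineProj hm l (by omega)

lemma isDiffeo_I_phi {N m : ℕ} (hm : m ≤ N) :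
    IsDiffeo (flagProj N m) (lineProj m) (I m ∘ phi N m) :=
  ⟨isSmooth_I_phi hm, flagInv hm, flagInv_I_phi hm, I_phi_flagInv hm, isSmooth_flagInv hm⟩

/-! ### Arcs -/

lemma gap_comap_pow {N k : ℕ} {L L' : Submodule ℂ (E N)}
    (hr : ∀ r < k, L.comap (z N ^ r) ≤ LinearMap.range (z N))
    (hr' : ∀ r < k, L'.comap (z N ^ r) ≤ LinearMap.range (z N)) :
    gap (L.comap (z N ^ k)) (L'.comap (z N ^ k)) = gap L L' := by
  induction k with
  | zero => rw [comap_z_pow_zero, comap_z_pow_zero]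
  | succ k ih =>
    rw [comap_z_pow_succ, comap_z_pow_succ, gap_comap (hr k (by omega)) (hr' k (by omega)),
      ih (fun r h => hr r (by omega)) (fun r h => hr' r (by omega))]

/-- Cancelling `z^{-k}` gives `gap L_t (z^{-(k+1)} L_i) = gap L_{i+1} (z⁻¹ L_i) = 1 - gap L_i
L_{i+1}`, the projection onto the complement of the `i`-th line. The gap over `L_t` determines the
next member. -/
lemma flagSeq_eq_comap_iff {N : ℕ} (y : ℕ → P1) {i t k : ℕ} (hit : i ≤ t) (ht : t < N)
    (h : flagSeq N y t = (flagSeq N y (i + 1)).comap (z N ^ k)) :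
    flagSeq N y (t + 1) = (flagSeq N y i).comap (z N ^ (k + 1)) ↔ y t = perp (y i) := by
  have hst := flagSeq_stable N y
  have hrt : (flagSeq N y (i + 1)).comap (z N ^ k) ≤ LinearMap.range (z N) :=
    h ▸ flagSeq_le_range y ht
  have hi : flagSeq N y i ≤ LinearMap.range (z N) := flagSeq_le_range y (by omega)
  have hle : (flagSeq N y (i + 1)).comap (z N ^ k) ≤ (flagSeq N y i).comap (z N ^ (k + 1)) := by
    rw [comap_z_pow_succ']
    exact Submodule.comap_mono (flagSeq_succ_le_comap N y i)
  have hgap : gap (flagSeq N y t) ((flagSeq N y i).comap (z N ^ (k + 1))) =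
      linePr (perp (y i)) := by
    rw [h, comap_z_pow_succ', gap_comap_pow, linePr_perp, eq_sub_iff_add_eq',
      ← gap_flagSeq y (show i < N by omega), gap_add_gap, gap_self_comap (by omega) hi]
    -- All intermediate preimages lie in `z^{-k} L_{i+1} = L_t`, which is inside the range of `z`
    -- because `t < N`.
    · intro r hr
      exact ((hst _).comap_pow_mono hr.le).trans hrt
    · intro r hr
      rw [← comap_z_pow_succ']
      refine le_trans ?_ (((hst _).comap_pow_mono (show r + 1 ≤ k from hr)).trans hrt)
      exact Submodule.comap_mono (flagSeq_le_succ N y i)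
  constructor
  · intro h'
    exact linePr_injective (by rw [← gap_flagSeq y ht, h', hgap])
  · intro h'
    refine (eq_flagSeq_succ y ht (h ▸ hle) ?_ (hgap.trans (by rw [h']))).symm
    rw [h, comap_z_pow_succ]
    exact Submodule.comap_mono (Submodule.comap_mono (flagSeq_le_succ N y i))

/-! ### Intervals closed under a crossingless matching -/

/-- The points `p, …, q - 1` are matched among themselves. -/
def Matching.ClosedOn {n : ℕ} (a : Matching n) (p q : ℕ) : Prop :=
  ∀ i : Fin (2 * n), p ≤ i → (i : ℕ) < q → p ≤ a.s i ∧ (a.s i : ℕ) < q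

lemma Matching.s_s {n : ℕ} (a : Matching n) (i : Fin (2 * n)) : a.s (a.s i) = i :=
  a.involutive i

/-- A point under an arc with its partner outside would give an arc crossing this one. -/
lemma Matching.closedOn_inside {n : ℕ} (a : Matching n) (i : Fin (2 * n)) :
    a.ClosedOn (i + 1) (a.s i) := by
  intro j hj hj'
  have hij : i < j := hj
  have hjt : j < a.s i := hj'
  have h1 : a.s j ≠ i := fun h => by
    rw [← h, a.s_s] at hjt
    exact lt_irrefl _ hjt
  have h2 : a.s j ≠ a.s i := fun h => hij.ne (a.involutive.injective h).symm
  have h3 : ¬ a.s j < i := fun h => a.crossingless ⟨a.s j, i, j, a.s i, h, hij, hjt, a.s_s j, rfl⟩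
  have h4 : ¬ a.s i < a.s j := fun h =>
    a.crossingless ⟨i, j, a.s i, a.s j, hij, hjt, h, rfl, rfl⟩
  have h5 : i < a.s j := lt_of_le_of_ne (not_lt.1 h3) h1.symm
  have h6 : a.s j < a.s i := lt_of_le_of_ne (not_lt.1 h4) h2
  exact ⟨h5, h6⟩

lemma Matching.closedOn_after {n : ℕ} (a : Matching n) {i : Fin (2 * n)} {q : ℕ} (hi : i ∈ a.O)
    (h : a.ClosedOn i q) : a.ClosedOn (a.s i + 1) q := by
  intro j hj hj'
  have hi' : (i : ℕ) < a.s i := hi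
  obtain ⟨h1, h2⟩ := h j (by omega) hj'
  refine ⟨?_, h2⟩
  by_contra h3
  have h4 : (a.s j : ℕ) ≠ a.s i := fun h => by
    rw [a.involutive.injective (Fin.ext h)] at hj
    omega
  by_cases h5 : (a.s j : ℕ) = i
  · rw [← Fin.ext h5, a.s_s] at hj
    omega
  · have := a.closedOn_inside i (a.s j) (by omega) (by omega)
    rw [a.s_s] at this
    omega

lemma Matching.closedOn_univ {n : ℕ} (a : Matching n) : a.ClosedOn 0 (2 * n) := fun i _ _ =>
  ⟨Nat.zero_le _, (a.s i).2⟩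

/-- A nonempty closed interval is the arc starting at `p`, the closed interval under it and the
closed interval after it, so induction on the length applies. The arc rule `H` is a hypothesis so
that it can come either from membership in `K_a` or from the lines. The evenness of the length also
shows that arcs join points of opposite parity. -/
lemma Matching.ClosedOn.eq_comap {N n : ℕ} (a : Matching n) {L : ℕ → Submodule ℂ (E N)}
    (H : ∀ i ∈ a.O, ∀ k, (a.s i : ℕ) = i + 2 * k + 1 →
      L (a.s i) = (L (i + 1)).comap (z N ^ k) → L (a.s i + 1) = (L i).comap (z N ^ (k + 1)))
    {p q : ℕ} (hpq : p ≤ q) (hq : q ≤ 2 * n) (h : a.ClosedOn p q) :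
    ∃ k, q = p + 2 * k ∧ L q = (L p).comap (z N ^ k) := by
  induction hd : q - p using Nat.strong_induction_on generalizing p q with
  | _ d ih =>
    obtain rfl | hlt := hpq.eq_or_lt
    · exact ⟨0, by omega, (comap_z_pow_zero _).symm⟩
    obtain ⟨i, rfl⟩ : ∃ i : Fin (2 * n), (i : ℕ) = p := ⟨⟨p, by omega⟩, rfl⟩
    obtain ⟨h1, h2⟩ := h i le_rfl hlt
    have hne : (a.s i : ℕ) ≠ i := fun h => a.ne_self i (Fin.ext h)
    have hO : i ∈ a.O := show (i : ℕ) < a.s i by omega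
    obtain ⟨k, hk, hLk⟩ := ih (a.s i - (i + 1)) (by omega) (by omega) (by omega)
      (a.closedOn_inside i) rfl
    have hL := H i hO k (by omega) hLk
    obtain ⟨k', hk', hLk'⟩ := ih (q - (a.s i + 1)) (by omega) (by omega) hq
      (a.closedOn_after hO h) rfl
    refine ⟨k + 1 + k', by omega, ?_⟩
    rw [hLk', hL, comap_z_pow_add _ (k + 1)]

lemma flagSeq_last_eq_En {N n : ℕ} (a : Matching n) {y : ℕ → P1}
    (H : ∀ i ∈ a.O, ∀ k, (a.s i : ℕ) = i + 2 * k + 1 →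
      flagSeq N y (a.s i) = (flagSeq N y (i + 1)).comap (z N ^ k) →
        flagSeq N y (a.s i + 1) = (flagSeq N y i).comap (z N ^ (k + 1))) :
    flagSeq N y (2 * n) = En N n := by
  obtain ⟨k, hk, h⟩ := Matching.ClosedOn.eq_comap a H (Nat.zero_le _) le_rfl a.closedOn_univ
  obtain rfl : k = n := by omega
  rw [h, En_eq_ker]
  rfl

/-! ### The components `K_a` correspond to the `S_a` -/

lemma Matching.d_eq {n : ℕ} (a : Matching n) {i : Fin (2 * n)} {k : ℕ}
    (h : (a.s i : ℕ) = i + 2 * k + 1) : a.d i = k + 1 := by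
  unfold Matching.d
  omega

lemma mem_K_iff {N n : ℕ} (hN : 2 * n ≤ N) (a : Matching n) (F : Y N (2 * n)) :
    F ∈ K N a ↔ I (2 * n) (phi N (2 * n) F) ∈ S a := by
  set y := extend (phi N (2 * n) F) with hy
  have hyv (j : Fin (2 * n)) : y j = phi N (2 * n) F j := extend_val _ j
  have hL := F.L_eq_flagSeq hN hyv
  have hS : I (2 * n) (phi N (2 * n) F) ∈ S a ↔
      ∀ j ∈ a.O, twist j (y j) = twist (a.s j) (y (a.s j)) := by
    simp only [hyv]
    rfl
  have hB : F ∈ B N n ↔ flagSeq N y (2 * n) = En N n := by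
    have : F ∈ B N n ↔ F.L (Fin.last (2 * n)) = En N n := Iff.rfl
    rw [this, hL, Fin.val_last]
  have hK : F ∈ K N a ↔ F ∈ B N n ∧
      ∀ j ∈ a.O, flagSeq N y (a.s j + 1) = zPre N n (a.d j) (flagSeq N y j) := by
    simp only [K, Set.mem_ofPred_eq, hL, Fin.val_succ, Fin.val_castSucc]
  have hodd {i j k : ℕ} (h : j = i + 2 * k + 1) : Odd (i + j) := ⟨i + k, by omega⟩
  rw [hK, hS, hB]
  constructor
  · rintro ⟨-, h⟩ j hj
    have H : ∀ i ∈ a.O, ∀ k, (a.s i : ℕ) = i + 2 * k + 1 →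
        flagSeq N y (a.s i) = (flagSeq N y (i + 1)).comap (z N ^ k) →
          flagSeq N y (a.s i + 1) = (flagSeq N y i).comap (z N ^ (k + 1)) := by
      intro i hi k hk _
      have hle : flagSeq N y (a.s i + 1) ≤ (flagSeq N y i).comap (z N ^ (k + 1)) := by
        rw [h i hi, a.d_eq hk]
        exact inf_le_right
      -- The condition of `K_a` only gives an inclusion, because of the intersection with `E_n`.
      -- Each `z⁻¹` raises the dimension by at most 2, so the right side has dimension at most `i +
      -- 2(k + 1) = a.s i + 1`.
      refine Submodule.eq_of_le_of_finrank_le hle ?_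
      have := finrank_comap_z_pow_le (flagSeq_stable N y i) (k + 1)
      rw [finrank_flagSeq y (by omega)] at this
      rw [finrank_flagSeq y (by omega)]
      omega
    have hj' : (j : ℕ) < a.s j := hj
    obtain ⟨k, hk, hin⟩ := Matching.ClosedOn.eq_comap a H (by omega) (by omega)
      (a.closedOn_inside j)
    have hk' : (a.s j : ℕ) = j + 2 * k + 1 := by omega
    rw [twist_eq_twist_iff (hodd hk')]
    exact (flagSeq_eq_comap_iff y (by omega) (by omega) hin).1 (H j hj k hk' hin)
  · intro h
    have H : ∀ i ∈ a.O, ∀ k, (a.s i : ℕ) = i + 2 * k + 1 →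
        flagSeq N y (a.s i) = (flagSeq N y (i + 1)).comap (z N ^ k) →
          flagSeq N y (a.s i + 1) = (flagSeq N y i).comap (z N ^ (k + 1)) := by
      intro i hi k hk hin
      exact (flagSeq_eq_comap_iff y (by omega) (by omega) hin).2
        ((twist_eq_twist_iff (hodd hk) _ _).1 (h i hi))
    have hlast := flagSeq_last_eq_En a H
    refine ⟨hlast, fun j hj => ?_⟩
    have hj' : (j : ℕ) < a.s j := hj
    obtain ⟨k, hk, hin⟩ := Matching.ClosedOn.eq_comap a H (by omega) (by omega)
      (a.closedOn_inside j)
    have hk' : (a.s j : ℕ) = j + 2 * k + 1 := by omega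
    rw [a.d_eq hk', zPre, ← H j hj k hk' hin, ← hlast]
    -- Since `E_n` is now the last member of the flag, intersecting with it changes nothing.
    exact (inf_eq_right.2 (flagSeq_mono N y (by omega))).symm

/-! ### Every flag in the Springer variety comes from a matching -/

/-- Without such a pair, `z L_{k+1} = L_k` for all `k < 2n`. Then `L_{2n-1} = z L_{2n}` lies in `ker
z^{n-1}`, whose dimension is at most `2n - 2`. -/
lemma exists_perp_succ {N n : ℕ} (hN : 2 * n ≤ N) (hn : 0 < n) {y : ℕ → P1}
    (h : flagSeq N y (2 * n) = LinearMap.ker (z N ^ n)) :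
    ∃ j, j + 1 < 2 * n ∧ y (j + 1) = perp (y j) := by
  by_contra! hne
  have hmap : ∀ k < 2 * n, (flagSeq N y (k + 1)).map (z N) = flagSeq N y k := by
    intro k hk
    induction k with
    | zero =>
      exact le_antisymm (Submodule.map_le_iff_le_comap.2 (flagSeq_succ_le_comap N y 0)) bot_le
    | succ k ih =>
      have hle : (flagSeq N y (k + 1 + 1)).map (z N) ≤ flagSeq N y (k + 1) :=
        Submodule.map_le_iff_le_comap.2 (flagSeq_succ_le_comap N y (k + 1))
      have hge : flagSeq N y k ≤ (flagSeq N y (k + 1 + 1)).map (z N) := by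
        rw [← ih (by omega)]
        exact Submodule.map_mono (flagSeq_le_succ N y (k + 1))
      -- `z L_{k+2}` lies between `L_k` and `L_{k+1}`. If it is not `L_{k+1}`, it is `L_k`; then
      -- `L_{k+2} = z⁻¹ L_k` by dimension, and the two lines are orthogonal.
      by_contra hlt
      have hfin := Submodule.finrank_lt_finrank_of_lt (lt_of_le_of_ne hle hlt)
      rw [finrank_flagSeq y (by omega)] at hfin
      have heq := Submodule.eq_of_le_of_finrank_le hge
        (by rw [finrank_flagSeq y (by omega)]; omega)
      have hle' : flagSeq N y (k + 1 + 1) ≤ (flagSeq N y k).comap (z N) :=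
        Submodule.map_le_iff_le_comap.1 heq.ge
      have hcomap := Submodule.eq_of_le_of_finrank_le hle' (by
        have := finrank_comap_z_le (flagSeq_stable N y k)
        rw [finrank_flagSeq y (by omega)] at this
        rw [finrank_flagSeq y (by omega)]
        omega)
      refine hne k hk ((flagSeq_eq_comap_iff (N := N) (k := 0) y (by omega) (by omega)
        (comap_z_pow_zero _).symm).1 ?_)
      rw [hcomap, zero_add, pow_one]
  obtain ⟨n, rfl⟩ : ∃ n', n = n' + 1 := ⟨n - 1, by omega⟩
  have hle : flagSeq N y (2 * n + 1) ≤ (⊥ : Submodule ℂ (E N)).comap (z N ^ n) := by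
    rw [← hmap (2 * n + 1) (by omega), Submodule.map_le_iff_le_comap, ← comap_z_pow_succ]
    exact h.le
  have h1 := Submodule.finrank_mono hle
  have h2 := finrank_comap_z_pow_le (stable_bot N) n
  rw [finrank_flagSeq y (by omega)] at h1
  rw [finrank_bot] at h2
  omega

/-! ### Deleting and inserting an adjacent pair -/

/-- The order embedding of `ℕ` into `ℕ` that omits `j` and `j + 1`. -/
def skip (j i : ℕ) : ℕ := if i < j then i else i + 2

/-- The left inverse of `skip j`. -/
def unskip (j i : ℕ) : ℕ := if i < j then i else i - 2

/-- Orthogonality gives `L_{j+2} = z⁻¹ L_j`. From there on, `z⁻¹` preserves gaps, so the preimages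
of the shorter flag grow by the same lines as the original one. -/
lemma flagSeq_skip {N : ℕ} {y : ℕ → P1} {j : ℕ} (hperp : y (j + 1) = perp (y j)) {i : ℕ}
    (hji : j ≤ i) (hi : i + 2 ≤ N) :
    flagSeq N y (i + 2) = (flagSeq N (y ∘ skip j) i).comap (z N) := by
  induction i, hji using Nat.le_induction with
  | base =>
    rw [(flagSeq_eq_comap_iff (i := j) (t := j + 1) (k := 0) y (by omega) (by omega)
      (comap_z_pow_zero _).symm).2 hperp, zero_add, pow_one]
    congr 1
    refine flagSeq_congr N fun i hi => ?_
    simp [skip, hi]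
  | succ i hji ih =>
    have ih := ih (by omega)
    refine (eq_flagSeq_succ y (by omega) ?_ ?_ ?_).symm
    · rw [ih]
      exact Submodule.comap_mono (flagSeq_le_succ N _ i)
    · rw [ih]
      exact Submodule.comap_mono (flagSeq_succ_le_comap N _ i)
    · rw [ih, gap_comap (flagSeq_le_range _ (by omega)) (flagSeq_le_range _ (by omega)),
        gap_flagSeq _ (by omega)]
      simp [skip, hji.not_gt]

/-- A crossingless matching of `0, …, m - 1` whose pairs have endpoints of opposite parity, given
by a function on `ℕ`. -/
structure IsNatMatching (m : ℕ) (s : ℕ → ℕ) : Prop where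
  lt : ∀ i < m, s i < m
  involutive : ∀ i < m, s (s i) = i
  odd : ∀ i < m, Odd (i + s i)
  crossingless : ∀ i j k l, i < j → j < k → k < l → l < m → s i = k → s j ≠ l

/-- Insertion of the pair `{j, j + 1}` into a matching. -/
def insertPair (j : ℕ) (s : ℕ → ℕ) (i : ℕ) : ℕ :=
  if i = j then j + 1 else if i = j + 1 then j else skip j (s (unskip j i))

lemma skip_ne (j i : ℕ) : skip j i ≠ j ∧ skip j i ≠ j + 1 := by
  unfold skip
  split_ifs <;> omega

lemma unskip_skip (j i : ℕ) : unskip j (skip j i) = i := by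
  unfold unskip skip
  split_ifs <;> omega

lemma exists_eq_skip {j i : ℕ} (h : i ≠ j) (h' : i ≠ j + 1) : ∃ i', i = skip j i' := by
  unfold skip
  by_cases h : i < j
  · exact ⟨i, by simp [h]⟩
  · exact ⟨i - 2, by rw [if_neg] <;> omega⟩

lemma insertPair_skip (j : ℕ) (s : ℕ → ℕ) (i : ℕ) :
    insertPair j s (skip j i) = skip j (s i) := by
  rw [insertPair, if_neg (skip_ne j i).1, if_neg (skip_ne j i).2, unskip_skip]

lemma insertPair_left (j : ℕ) (s : ℕ → ℕ) : insertPair j s j = j + 1 := by simp [insertPair]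

lemma insertPair_right (j : ℕ) (s : ℕ → ℕ) : insertPair j s (j + 1) = j := by simp [insertPair]

lemma skip_lt_skip {j i i' : ℕ} : skip j i < skip j i' ↔ i < i' := by
  unfold skip
  split_ifs <;> omega

lemma skip_lt {j i m : ℕ} (h : j ≤ m) : skip j i < m + 2 ↔ i < m := by
  unfold skip
  split_ifs <;> omega

/-- An adjacent pair has no room to cross another arc, and `skip` preserves order and parity, as it
shifts by 0 or 2. -/
lemma IsNatMatching.insertPair {m j : ℕ} {s : ℕ → ℕ} (h : IsNatMatching m s) (hj : j ≤ m) :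
    IsNatMatching (m + 2) (insertPair j s) := by
  have cases (i : ℕ) : i = j ∨ i = j + 1 ∨ ∃ i', i = skip j i' := by
    by_cases h1 : i = j
    · exact .inl h1
    by_cases h2 : i = j + 1
    · exact .inr (.inl h2)
    · exact .inr (.inr (exists_eq_skip h1 h2))
  refine ⟨fun i hi => ?_, fun i hi => ?_, fun i hi => ?_, ?_⟩
  · obtain rfl | rfl | ⟨i, rfl⟩ := cases i
    · rw [insertPair_left]; omega
    · rw [insertPair_right]; omega
    · rw [skip_lt hj] at hi
      rw [insertPair_skip, skip_lt hj]
      exact h.lt i hi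
  · obtain rfl | rfl | ⟨i, rfl⟩ := cases i
    · rw [insertPair_left, insertPair_right]
    · rw [insertPair_right, insertPair_left]
    · rw [skip_lt hj] at hi
      rw [insertPair_skip, insertPair_skip, h.involutive i hi]
  · obtain rfl | rfl | ⟨i, rfl⟩ := cases i
    · rw [insertPair_left]; exact ⟨i, by omega⟩
    · rw [insertPair_right]; exact ⟨j, by omega⟩
    · rw [skip_lt hj] at hi
      rw [insertPair_skip]
      have := h.odd i hi
      unfold skip
      split_ifs <;> grind
  · intro a b c d hab hbc hcd hd hac hbd
    obtain rfl | rfl | ⟨a, rfl⟩ := cases a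
    · rw [insertPair_left] at hac; omega
    · rw [insertPair_right] at hac; omega
    obtain rfl | rfl | ⟨b, rfl⟩ := cases b
    · rw [insertPair_left] at hbd; omega
    · rw [insertPair_right] at hbd; omega
    rw [insertPair_skip] at hac hbd
    subst hac hbd
    rw [skip_lt_skip] at hab hbc hcd
    rw [skip_lt hj] at hd
    exact h.crossingless a b _ _ hab hbc hcd hd rfl rfl

lemma exists_natMatching {N n : ℕ} (hN : 2 * n ≤ N) {y : ℕ → P1}
    (h : flagSeq N y (2 * n) = LinearMap.ker (z N ^ n)) :
    ∃ s, IsNatMatching (2 * n) s ∧ ∀ i < 2 * n, y (s i) = perp (y i) := by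
  induction n generalizing y with
  | zero => exact ⟨id, ⟨by omega, by omega, by omega, by omega⟩, by omega⟩
  | succ n ih =>
    obtain ⟨j, hj, hperp⟩ := exists_perp_succ hN (Nat.succ_pos n) h
    have hskip := flagSeq_skip (N := N) hperp (i := 2 * n) (by omega) (by omega)
    have hlast : flagSeq N (y ∘ skip j) (2 * n) = LinearMap.ker (z N ^ n) := by
      have heq : (flagSeq N (y ∘ skip j) (2 * n)).comap (z N) =
          (LinearMap.ker (z N ^ n)).comap (z N) := by
        rw [← hskip, show 2 * n + 2 = 2 * (n + 1) by ring, h, LinearMap.ker, LinearMap.ker,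
          comap_z_pow_succ]
      -- Both subspaces lie in the range of `z`, so applying `z` undoes `z⁻¹`.
      have := congrArg (Submodule.map (z N)) heq
      rwa [Submodule.map_comap_eq_of_le (flagSeq_le_range _ (by omega)),
        Submodule.map_comap_eq_of_le (ker_z_pow_le_range (by omega))] at this
    obtain ⟨s, hs, hsy⟩ := ih (by omega) hlast
    refine ⟨insertPair j s, hs.insertPair (by omega), fun i hi => ?_⟩
    by_cases h1 : i = j
    · rw [h1, insertPair_left, hperp]
    by_cases h2 : i = j + 1
    · rw [h2, insertPair_right, hperp, perp_perp]
    obtain ⟨i, rfl⟩ := exists_eq_skip h1 h2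
    rw [insertPair_skip]
    exact hsy i ((skip_lt (by omega)).1 hi)

/-- The matching given by a function on `ℕ`. -/
def IsNatMatching.toMatching {n : ℕ} {s : ℕ → ℕ} (h : IsNatMatching (2 * n) s) : Matching n where
  s i := ⟨s i, h.lt i i.2⟩
  involutive i := Fin.ext (h.involutive i i.2)
  ne_self i hi := by
    have h1 := h.odd i i.2
    have h2 : s i = i := congrArg Fin.val hi
    rw [h2] at h1
    grind
  crossingless := by
    rintro ⟨i, j, k, l, hij, hjk, hkl, hik, hjl⟩
    exact h.crossingless i j k l hij hjk hkl l.2 (congrArg Fin.val hik) (congrArg Fin.val hjl)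

lemma mem_B_iff {N n : ℕ} (hN : 2 * n ≤ N) (F : Y N (2 * n)) :
    F ∈ B N n ↔ I (2 * n) (phi N (2 * n) F) ∈ STilde n := by
  constructor
  · intro hF
    set y := extend (phi N (2 * n) F) with hy
    have hyv (j : Fin (2 * n)) : y j = phi N (2 * n) F j := extend_val _ j
    have hlast : flagSeq N y (2 * n) = LinearMap.ker (z N ^ n) := by
      rw [← En_eq_ker, ← show F.L (Fin.last (2 * n)) = En N n from hF, F.L_eq_flagSeq hN hyv,
        Fin.val_last]
    obtain ⟨s, hs, hsy⟩ := exists_natMatching hN hlast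
    refine Set.mem_iUnion.2 ⟨hs.toMatching, fun j _ => ?_⟩
    rw [I_apply, I_apply, ← hyv, ← hyv]
    exact (twist_eq_twist_iff (hs.odd j j.2) _ _).2 (hsy j j.2)
  · intro h
    obtain ⟨a, ha⟩ := Set.mem_iUnion.1 h
    -- A flag sent into `S_a` lies in `K_a`, and `K_a` is part of the Springer variety by
    -- definition.
    exact ((mem_K_iff hN a F).2 ha).1

lemma image_I_phi_eq {N n : ℕ} (hN : 2 * n ≤ N) {A : Set (Y N (2 * n))}
    {T : Set (Fin (2 * n) → P1)} (h : ∀ F, F ∈ A ↔ I (2 * n) (phi N (2 * n) F) ∈ T) :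
    (I (2 * n) ∘ phi N (2 * n)) '' A = T := by
  ext l
  constructor
  · rintro ⟨F, hF, rfl⟩
    exact (h F).1 hF
  · intro hl
    refine ⟨flagInv hN l, (h _).2 ?_, I_phi_flagInv hN l⟩
    rwa [I_phi_flagInv]

end Springer

end

theorem proposition2 (N n : ℕ) (hN : 2 * n ≤ N) :
    Springer.IsDiffeo (Springer.flagProj N (2 * n)) (Springer.lineProj (2 * n))
        (Springer.I (2 * n) ∘ Springer.phi N (2 * n)) ∧
      (∀ a : Springer.Matching n,
        (Springer.I (2 * n) ∘ Springer.phi N (2 * n)) '' Springer.K N a = Springer.S a) ∧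
      (Springer.I (2 * n) ∘ Springer.phi N (2 * n)) '' Springer.B N n = Springer.STilde n :=
  ⟨Springer.isDiffeo_I_phi hN, fun a => Springer.image_I_phi_eq hN (Springer.mem_K_iff hN a),
    Springer.image_I_phi_eq hN (Springer.mem_B_iff hN)⟩
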